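/- Let $\Bbbk$ be an algebraically closed field, $A$ a $\Bbbk$-algebra, and $\mathrm{mod}\,A$ the category of left $A$-modules that are finite-dimensional over $\Bbbk$. Let $r\ge 1$ and let $E_i$ ($i\in\mathbb Z/r$) be objects of $\mathrm{mod}\,A$ such that 1. $\operatorname{End}_A(E_i)=\Bbbk$ for every $i$ and $\operatorname{Hom}_A(E_i,E_j)=0$ for $i\ne j$ (a brick set); 2. $\tau E_i\cong E_{i-1}$ for every $i\in\mathbb Z/r$, where $\tau$ is the Auslander–Reiten translation of $\mathrm{mod}\,A$, i.e. there is an almost split sequence $0\to E_{i-1}\to M_i\to E_i\to 0$ in $\mathrm{mod}\,A$ (a $\tau$-cycle); 3. $\operatorname{Ext}^2_A(E_i,E_j)=0$ for all $i,j$ (self-hereditary). Let $\mathcal E$ be the extension category of this family: the full subcategory of $\mathrm{mod}\,A$ consisting of $0$ and of all modules $M$ that have a finite chain of submodules $M=M_0\supsetneq M_1\supsetneq\cdots\supsetneq M_l=0$ in which each $M_s/M_{s+1}$ is isomorphic to one of the $E_i$. It is an abelian category. Then the Frobenius–Perron dimension of $\mathcal E$ equals $1$: $$\operatorname{fpdim}\mathcal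 E:=\sup_{n\ge1}\ \sup_{\{X_1,\dots,X_n\}}\rho\Big(\big(\dim_\Bbbk\operatorname{Ext}^1_{\mathcal E}(X_s,X_t)\big)_{1\le s,t\le n}\Big)=1 .$$ Here $\{X_1,\dots,X_n\}$ runs over all brick sets of $\mathcal E$, i.e. objects of $\mathcal E$ with $\operatorname{End}(X_s)=\Bbbk$ for all $s$ and $\operatorname{Hom}(X_s,X_t)=0$ for $s\neq t$. The spectral radius $\rho$ of a matrix with finite entries is the largest absolute value of its complex eigenvalues; if some entries are infinite, they are replaced by real variables and $\rho$ is the limit inferior of the resulting spectral radii as all these variables tend to $\infty$. -/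

import Mathlib

open CategoryTheory CategoryTheory.Limits CategoryTheory.Abelian Filter
open scoped ENNReal ModuleCat

universe u v w

noncomputable section

namespace FP

/-! ### Filtrations by a family of modules and the extension category -/

section Filtration

variable {A : Type v} [Ring A] {ι : Type w} (E : ι → ModuleCat.{v} A)

/-- The module `M` has a chain of submodules `M = M₀ ⊋ M₁ ⊋ ⋯ ⊋ M_l = 0` such that every
subquotient `Mᵢ / Mᵢ₊₁` is isomorphic to some member of the family `E`. -/
def HasFiltration (l : ℕ) (M : Type v) [AddCommGroup M] [Module A M] : Prop :=
  ∃ F : ℕ → Submodule A M, F 0 = ⊤ ∧ F l = ⊥ ∧ ∀ i < l, F (i + 1) < F i ∧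
    ∃ j, Nonempty ((F i ⧸ (F (i + 1)).submoduleOf (F i)) ≃ₗ[A] E j)

/-- The extension category of the family `E`, as a property of left `A`-modules: the modules
which have a finite filtration with subquotients in `E` (length `0` gives the zero modules). -/
def extensionCategory : ObjectProperty (ModuleCat.{v} A) :=
  fun M => ∃ l : ℕ, HasFiltration E l M

variable {E}
variable {M N L : Type v} [AddCommGroup M] [Module A M] [AddCommGroup N] [Module A N]
  [AddCommGroup L] [Module A L]

lemma HasFiltration.congr {l : ℕ} (h : HasFiltration E l M) (e : M ≃ₗ[A] N) :
    HasFiltration E l N := by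
  obtain ⟨F, h0, hl, hs⟩ := h
  refine ⟨fun i => (F i).map (e : M →ₗ[A] N), by simp [h0], by simp [hl], fun i hi => ?_⟩
  obtain ⟨hlt, j, ⟨q⟩⟩ := hs i hi
  refine ⟨(Submodule.map_strictMono_of_injective e.injective) hlt, j, ⟨?_⟩⟩
  refine (Submodule.Quotient.equiv _ _ (e.submoduleMap (F i)) ?_).symm ≪≫ₗ q
  ext ⟨x, hx⟩
  simp only [Submodule.mem_map, Submodule.submoduleOf, Submodule.mem_comap]
  constructor
  · rintro ⟨⟨y, hy⟩, hy', h⟩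
    exact ⟨y, hy', congrArg Subtype.val h⟩
  · rintro ⟨y, hy, h⟩
    exact ⟨⟨y, hlt.le hy⟩, hy, Subtype.ext h⟩

lemma hasFiltration_zero_iff : HasFiltration E 0 M ↔ Subsingleton M := by
  constructor
  · rintro ⟨F, h0, hl, -⟩
    exact (Submodule.subsingleton_iff A).1 (subsingleton_of_bot_eq_top (hl.symm.trans h0))
  · intro h
    exact ⟨fun _ => ⊤, rfl, Subsingleton.elim _ _, fun i hi => absurd hi (by simp)⟩

lemma HasFiltration.exists_of_succ {l : ℕ} (h : HasFiltration E (l + 1) M) :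
    ∃ j, ∃ g : M →ₗ[A] E j, Function.Surjective g ∧ HasFiltration E l (LinearMap.ker g) := by
  obtain ⟨F, h0, hl, hs⟩ := h
  obtain ⟨-, j, ⟨q⟩⟩ := hs 0 (by omega)
  let t : M ≃ₗ[A] F 0 := (LinearEquiv.ofTop (F 0) h0).symm
  let g : M →ₗ[A] E j := q.toLinearMap ∘ₗ ((F 1).submoduleOf (F 0)).mkQ ∘ₗ t.toLinearMap
  have hg : LinearMap.ker g = F 1 := by
    ext x
    simp only [g, LinearMap.mem_ker, LinearMap.comp_apply, LinearEquiv.coe_coe,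
      LinearEquiv.map_eq_zero_iff, Submodule.mkQ_apply, Submodule.Quotient.mk_eq_zero]
    rfl
  refine ⟨j, g, q.surjective.comp ((Submodule.mkQ_surjective _).comp t.surjective), ?_⟩
  rw [hg]
  have hle : ∀ i, i ≤ l → F (i + 1) ≤ F 1 := by
    intro i hi
    induction i with
    | zero => exact le_rfl
    | succ n ih => exact (hs (n + 1) (by omega)).1.le.trans (ih (by omega))
  refine ⟨fun i => (F (i + 1)).submoduleOf (F 1), by simp [Submodule.submoduleOf],
    by simp [Submodule.submoduleOf, hl], fun i hi => ?_⟩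
  obtain ⟨hlt, j, ⟨q⟩⟩ := hs (i + 1) (by omega)
  refine ⟨?_, j, ⟨?_⟩⟩
  · refine lt_of_le_of_ne (Submodule.comap_mono hlt.le) fun heq => hlt.ne ?_
    have := congrArg (Submodule.map (F 1).subtype) heq
    simp only [Submodule.submoduleOf, Submodule.map_comap_subtype] at this
    rwa [inf_eq_right.2 (hle _ (by omega)), inf_eq_right.2 (hle _ (by omega))] at this
  · refine Submodule.Quotient.equiv _ _
      (Submodule.submoduleOfEquivOfLe (hle i (by omega))) ?_ ≪≫ₗ q
    ext ⟨x, hx⟩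
    simp only [Submodule.submoduleOf, Submodule.mem_comap]
    constructor
    · rintro ⟨⟨⟨y, hy⟩, hy1⟩, hy', h⟩
      obtain rfl : y = x := congrArg Subtype.val h
      exact hy'
    · intro h
      exact ⟨⟨⟨x, hle i (by omega) hx⟩, hx⟩, h, rfl⟩

lemma HasFiltration.succ [∀ j, Nontrivial (E j)] {l : ℕ} {j : ι} (g : M →ₗ[A] E j)
    (hg : Function.Surjective g) (h : HasFiltration E l (LinearMap.ker g)) :
    HasFiltration E (l + 1) M := by
  obtain ⟨F, h0, hl, hs⟩ := h
  let G : ℕ → Submodule A M := fun i =>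
    match i with
    | 0 => ⊤
    | i + 1 => (F i).map (LinearMap.ker g).subtype
  have h1 : G 1 = LinearMap.ker g := by simp [G, h0]
  refine ⟨G, rfl, by simp [G, hl], fun i hi => ?_⟩
  cases i with
  | zero =>
    refine ⟨?_, j, ⟨?_⟩⟩
    · rw [zero_add, h1]
      refine lt_top_iff_ne_top.2 fun h => ?_
      obtain ⟨y, hy⟩ := exists_ne (0 : E j)
      obtain ⟨x, rfl⟩ := hg y
      exact hy (LinearMap.mem_ker.1 (h ▸ Submodule.mem_top))
    · have hk : (G (0 + 1)).submoduleOf (G 0) =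
          LinearMap.ker (g ∘ₗ (G 0).subtype) := by
        rw [zero_add, h1]; rfl
      exact Submodule.quotEquivOfEq _ _ hk ≪≫ₗ
        LinearMap.quotKerEquivOfSurjective _ (fun y => by
          obtain ⟨x, rfl⟩ := hg y
          exact ⟨⟨x, trivial⟩, rfl⟩)
  | succ i =>
    obtain ⟨hlt, j, ⟨q⟩⟩ := hs i (by omega)
    refine ⟨Submodule.map_strictMono_of_injective (Submodule.injective_subtype _) hlt, j, ⟨?_⟩⟩
    refine (Submodule.Quotient.equiv _ _
      (Submodule.equivSubtypeMap (LinearMap.ker g) (F i)) ?_).symm ≪≫ₗ q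
    ext ⟨x, hx⟩
    simp only [Submodule.mem_map, Submodule.submoduleOf, Submodule.mem_comap]
    constructor
    · rintro ⟨⟨y, hy⟩, hy', h⟩
      exact ⟨y, hy', congrArg Subtype.val h⟩
    · rintro ⟨y, hy, h⟩
      exact ⟨⟨y, hlt.le hy⟩, hy, Subtype.ext h⟩

/-- Extensions of filtered modules are filtered. -/
lemma HasFiltration.extension [∀ j, Nontrivial (E j)] {a : ℕ} : ∀ {b : ℕ} {M N : Type v}
    [AddCommGroup M] [Module A M] [AddCommGroup N] [Module A N] (g : M →ₗ[A] N)
    (_ : Function.Surjective g) (_ : HasFiltration E a (LinearMap.ker g))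
    (_ : HasFiltration E b N), HasFiltration E (a + b) M := by
  intro b
  induction b with
  | zero =>
    intro M N _ _ _ _ g hg ha hb
    rw [hasFiltration_zero_iff] at hb
    exact ha.congr (LinearEquiv.ofTop _ (LinearMap.ker_eq_top.2 (Subsingleton.elim _ _)))
  | succ b ih =>
    intro M N _ _ _ _ g hg ha hb
    obtain ⟨j, h, hh, hb⟩ := hb.exists_of_succ
    refine HasFiltration.succ (h ∘ₗ g) (hh.comp hg) ?_
    let g' : LinearMap.ker (h ∘ₗ g) →ₗ[A] LinearMap.ker h :=
      g.restrict (fun x hx => hx)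
    have hg' : Function.Surjective g' := by
      rintro ⟨y, hy⟩
      obtain ⟨x, rfl⟩ := hg y
      exact ⟨⟨x, hy⟩, rfl⟩
    refine ih g' hg' (ha.congr ?_) hb
    refine LinearEquiv.ofBijective
      (LinearMap.codRestrict (LinearMap.ker g')
        (LinearMap.codRestrict (LinearMap.ker (h ∘ₗ g)) (LinearMap.ker g).subtype
          (fun x => by simp)) (fun x => Subtype.ext x.2)) ⟨?_, ?_⟩
    · intro x y hxy
      exact Subtype.ext (congrArg
        (fun z : LinearMap.ker g' => ((z : LinearMap.ker (h ∘ₗ g)) : M)) hxy)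
    · rintro ⟨⟨x, hx⟩, hx'⟩
      exact ⟨⟨x, congrArg Subtype.val hx'⟩, rfl⟩

/-- A filtered module of positive length contains a member of the family as a bottom step. -/
lemma HasFiltration.exists_bottom [∀ j, Nontrivial (E j)] : ∀ {l : ℕ} {M : Type v}
    [AddCommGroup M] [Module A M] (_ : HasFiltration E (l + 1) M),
    ∃ j, ∃ f : E j →ₗ[A] M, Function.Injective f ∧
      HasFiltration E l (M ⧸ LinearMap.range f) := by
  intro l
  induction l with
  | zero =>
    intro M _ _ h
    obtain ⟨j, g, hg, hk⟩ := h.exists_of_succ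
    rw [hasFiltration_zero_iff] at hk
    have hinj : Function.Injective g := LinearMap.ker_eq_bot.1 (Submodule.eq_bot_of_subsingleton)
    let e := LinearEquiv.ofBijective g ⟨hinj, hg⟩
    refine ⟨j, e.symm.toLinearMap, e.symm.injective, ?_⟩
    rw [hasFiltration_zero_iff, Submodule.Quotient.subsingleton_iff]
    exact LinearMap.range_eq_top.2 e.symm.surjective
  | succ l ih =>
    intro M _ _ h
    obtain ⟨j, g, hg, hk⟩ := h.exists_of_succ
    obtain ⟨i, f, hf, hq⟩ := ih hk
    let f' : E i →ₗ[A] M := (LinearMap.ker g).subtype ∘ₗ f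
    have hle : LinearMap.range f' ≤ LinearMap.ker g := by
      rintro _ ⟨x, rfl⟩
      exact (f x).2
    refine ⟨i, f', Subtype.val_injective.comp hf, ?_⟩
    let g' := (LinearMap.range f').liftQ g hle
    refine HasFiltration.succ g' (fun y => ?_) (hq.congr ?_)
    · obtain ⟨x, rfl⟩ := hg y
      exact ⟨Submodule.Quotient.mk x, rfl⟩
    · refine LinearEquiv.ofBijective (LinearMap.codRestrict (LinearMap.ker g')
        ((LinearMap.range f).mapQ (LinearMap.range f') (LinearMap.ker g).subtype ?_) ?_) ⟨?_, ?_⟩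
      · rintro _ ⟨x, rfl⟩
        exact ⟨x, rfl⟩
      · intro x
        induction x using Submodule.Quotient.induction_on with | _ x => exact x.2
      · rw [← LinearMap.ker_eq_bot, LinearMap.ker_codRestrict, LinearMap.ker_eq_bot']
        intro x hx
        induction x using Submodule.Quotient.induction_on with | _ x =>
        rw [Submodule.mapQ_apply, Submodule.Quotient.mk_eq_zero] at hx
        rw [Submodule.Quotient.mk_eq_zero]
        obtain ⟨y, hy⟩ := hx
        exact ⟨y, Subtype.ext hy⟩
      · rintro ⟨x, hx⟩
        induction x using Submodule.Quotient.induction_on with | _ x =>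
        exact ⟨Submodule.Quotient.mk ⟨x, hx⟩, rfl⟩

/-- A nonzero map from a member of a family of pairwise orthogonal bricks to a filtered module is
injective with filtered cokernel. -/
lemma HasFiltration.of_map_brick [∀ j, Nontrivial (E j)]
    (hE : ∀ i j (f : E i →ₗ[A] E j), f ≠ 0 → Function.Bijective f) {i : ι} :
    ∀ {l : ℕ} {M : Type v} [AddCommGroup M] [Module A M] (_ : HasFiltration E l M)
      (f : E i →ₗ[A] M) (_ : f ≠ 0),
      Function.Injective f ∧ ∃ l', HasFiltration E l' (M ⧸ LinearMap.range f) := by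
  intro l
  induction l with
  | zero =>
    intro M _ _ h f hf
    rw [hasFiltration_zero_iff] at h
    exact absurd (LinearMap.ext fun x => Subsingleton.elim _ _) hf
  | succ l ih =>
    intro M _ _ h f hf
    obtain ⟨j, g, hg, hk⟩ := h.exists_of_succ
    by_cases hgf : g ∘ₗ f = 0
    · let f' : E i →ₗ[A] LinearMap.ker g :=
        f.codRestrict _ (fun x => LinearMap.congr_fun hgf x)
      have hf' : f' ≠ 0 := fun h0 => hf (LinearMap.ext fun x =>
        congrArg Subtype.val (LinearMap.congr_fun h0 x))
      obtain ⟨hinj, l', hl'⟩ := ih hk f' hf'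
      refine ⟨fun x y hxy => hinj (Subtype.ext hxy), l' + 1, ?_⟩
      have hle : LinearMap.range f ≤ LinearMap.ker g := by
        rintro _ ⟨x, rfl⟩
        exact LinearMap.congr_fun hgf x
      let g' := (LinearMap.range f).liftQ g hle
      refine HasFiltration.succ g' (fun y => ?_) (hl'.congr ?_)
      · obtain ⟨x, rfl⟩ := hg y
        exact ⟨Submodule.Quotient.mk x, rfl⟩
      · refine LinearEquiv.ofBijective (LinearMap.codRestrict (LinearMap.ker g')
          ((LinearMap.range f').mapQ (LinearMap.range f) (LinearMap.ker g).subtype ?_) ?_)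
          ⟨?_, ?_⟩
        · rintro _ ⟨x, rfl⟩
          exact ⟨x, rfl⟩
        · intro x
          induction x using Submodule.Quotient.induction_on with | _ x => exact x.2
        · rw [← LinearMap.ker_eq_bot, LinearMap.ker_codRestrict, LinearMap.ker_eq_bot']
          intro x hx
          induction x using Submodule.Quotient.induction_on with | _ x =>
          rw [Submodule.mapQ_apply, Submodule.Quotient.mk_eq_zero] at hx
          rw [Submodule.Quotient.mk_eq_zero]
          obtain ⟨y, hy⟩ := hx
          exact ⟨y, Subtype.ext hy⟩
        · rintro ⟨x, hx⟩
          induction x using Submodule.Quotient.induction_on with | _ x =>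
          exact ⟨Submodule.Quotient.mk ⟨x, hx⟩, rfl⟩
    · have hb := hE i j _ hgf
      refine ⟨Function.Injective.of_comp hb.1, l, hk.congr ?_⟩
      refine LinearEquiv.ofBijective
        ((LinearMap.range f).mkQ ∘ₗ (LinearMap.ker g).subtype) ⟨?_, ?_⟩
      · rw [← LinearMap.ker_eq_bot, LinearMap.ker_eq_bot']
        rintro ⟨x, hx⟩ hx'
        obtain ⟨y, hy⟩ := (Submodule.Quotient.mk_eq_zero _).1 hx'
        have hy' : (g ∘ₗ f) y = (g ∘ₗ f) 0 := by
          rw [map_zero, LinearMap.comp_apply, hy]; exact hx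
        have := hb.1 hy'
        subst this
        exact Subtype.ext (hy.symm.trans (map_zero _))
      · intro x
        induction x using Submodule.Quotient.induction_on with | _ x =>
        obtain ⟨y, hy⟩ := hb.2 (g x)
        refine ⟨⟨x - f y, by simpa [sub_eq_zero] using hy.symm⟩, ?_⟩
        refine (Submodule.Quotient.eq _).2 ⟨-y, ?_⟩
        simp

/-- For a family of pairwise orthogonal bricks, kernels and cokernels of maps between filtered
modules are filtered. -/
lemma HasFiltration.ker_and_coker [∀ j, Nontrivial (E j)]
    (hE : ∀ i j (f : E i →ₗ[A] E j), f ≠ 0 → Function.Bijective f) :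
    ∀ {l m : ℕ} {M N : Type v} [AddCommGroup M] [Module A M] [AddCommGroup N] [Module A N]
      (_ : HasFiltration E l M) (_ : HasFiltration E m N) (f : M →ₗ[A] N),
      (∃ a, HasFiltration E a (LinearMap.ker f)) ∧
        ∃ b, HasFiltration E b (N ⧸ LinearMap.range f) := by
  intro l
  induction l with
  | zero =>
    intro m M N _ _ _ _ hM hN f
    rw [hasFiltration_zero_iff] at hM
    refine ⟨⟨0, hasFiltration_zero_iff.2 inferInstance⟩, m, hN.congr ?_⟩
    have : LinearMap.range f = ⊥ := by
      rw [LinearMap.range_eq_bot]; exact LinearMap.ext fun x => by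
        rw [Subsingleton.elim x 0]; simp
    exact (Submodule.quotEquivOfEqBot _ this).symm
  | succ l ih =>
    intro m M N _ _ _ _ hM hN f
    obtain ⟨j, e, he, hq⟩ := hM.exists_bottom
    by_cases hfe : f ∘ₗ e = 0
    · have hle : LinearMap.range e ≤ LinearMap.ker f := by
        rintro _ ⟨x, rfl⟩
        exact LinearMap.congr_fun hfe x
      let f' := (LinearMap.range e).liftQ f hle
      obtain ⟨⟨a, ha⟩, b, hb⟩ := ih hq hN f'
      refine ⟨⟨0 + 1 + a, ?_⟩, b, ?_⟩
      · let t : LinearMap.ker f →ₗ[A] LinearMap.ker f' :=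
          LinearMap.codRestrict _ ((LinearMap.range e).mkQ ∘ₗ (LinearMap.ker f).subtype)
            (fun x => x.2)
        refine HasFiltration.extension t ?_ ?_ ha
        · rintro ⟨x, hx⟩
          induction x using Submodule.Quotient.induction_on with | _ x =>
          exact ⟨⟨x, hx⟩, rfl⟩
        · let s : E j →ₗ[A] LinearMap.ker t :=
            LinearMap.codRestrict _ (LinearMap.codRestrict _ e
              (fun x => LinearMap.congr_fun hfe x))
              (fun x => Subtype.ext ((Submodule.Quotient.mk_eq_zero _).2 ⟨x, rfl⟩))
          have hs : Function.Bijective s := by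
            refine ⟨fun x y hxy => he
              (congrArg (fun z : LinearMap.ker t => ((z : LinearMap.ker f) : M)) hxy), ?_⟩
            rintro ⟨⟨x, hx⟩, hx'⟩
            obtain ⟨y, hy⟩ :=
              (Submodule.Quotient.mk_eq_zero _).1 (congrArg Subtype.val hx')
            exact ⟨y, Subtype.ext (Subtype.ext hy)⟩
          let s' := LinearEquiv.ofBijective s hs
          refine HasFiltration.succ s'.symm.toLinearMap s'.symm.surjective ?_
          rw [hasFiltration_zero_iff, LinearEquiv.ker]
          infer_instance
      · have : LinearMap.range f' = LinearMap.range f := Submodule.range_liftQ _ _ _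
        rwa [this] at hb
    · obtain ⟨hinj, m', hm'⟩ := HasFiltration.of_map_brick hE hN (f ∘ₗ e) hfe
      let f' : (M ⧸ LinearMap.range e) →ₗ[A] (N ⧸ LinearMap.range (f ∘ₗ e)) :=
        (LinearMap.range e).mapQ _ f (by
          rintro _ ⟨x, rfl⟩
          exact ⟨x, rfl⟩)
      obtain ⟨⟨a, ha⟩, b, hb⟩ := ih hq hm' f'
      refine ⟨⟨a, ha.congr ?_⟩, b, hb.congr ?_⟩
      · refine (LinearEquiv.ofBijective (LinearMap.codRestrict (LinearMap.ker f')
          ((LinearMap.range e).mkQ ∘ₗ (LinearMap.ker f).subtype) ?_) ⟨?_, ?_⟩).symm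
        · rintro ⟨x, hx⟩
          refine (Submodule.Quotient.mk_eq_zero _).2 ?_
          rw [LinearMap.mem_ker] at hx
          simp [hx]
        · rw [← LinearMap.ker_eq_bot, LinearMap.ker_codRestrict, LinearMap.ker_eq_bot']
          rintro ⟨x, hx⟩ hx'
          obtain ⟨y, hy⟩ := (Submodule.Quotient.mk_eq_zero _).1 hx'
          have hy' : (f ∘ₗ e) y = (f ∘ₗ e) 0 := by
            rw [map_zero, LinearMap.comp_apply, hy]; exact hx
          have := hinj hy'
          subst this
          exact Subtype.ext (hy.symm.trans (map_zero _))
        · rintro ⟨x, hx⟩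
          induction x using Submodule.Quotient.induction_on with | _ x =>
          obtain ⟨y, hy⟩ := (Submodule.Quotient.mk_eq_zero _).1 hx
          refine ⟨⟨x - e y, ?_⟩, Subtype.ext ((Submodule.Quotient.eq _).2 ⟨-y, ?_⟩)⟩
          · rw [LinearMap.mem_ker, map_sub, sub_eq_zero]
            exact hy.symm
          · simp
      · refine (LinearEquiv.ofBijective ((LinearMap.range f).mapQ (LinearMap.range f')
          (LinearMap.range (f ∘ₗ e)).mkQ ?_) ⟨?_, ?_⟩).symm
        · rintro _ ⟨x, rfl⟩
          exact ⟨Submodule.Quotient.mk x, rfl⟩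
        · rw [← LinearMap.ker_eq_bot, LinearMap.ker_eq_bot']
          intro x hx
          induction x using Submodule.Quotient.induction_on with | _ x =>
          obtain ⟨y, hy⟩ := (Submodule.Quotient.mk_eq_zero _).1 hx
          induction y using Submodule.Quotient.induction_on with | _ y =>
          obtain ⟨z, hz⟩ := (Submodule.Quotient.eq _).1 hy
          refine (Submodule.Quotient.mk_eq_zero _).2 ⟨y - e z, ?_⟩
          rw [map_sub]
          have hz' : f (e z) = f y - x := hz
          rw [hz']; abel
        · intro x
          induction x using Submodule.Quotient.induction_on with | _ x =>
          induction x using Submodule.Quotient.induction_on with | _ x =>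
          exact ⟨Submodule.Quotient.mk x, rfl⟩

end Filtration

/-! ### Bricks, brick sets and the Frobenius-Perron dimension -/

section FPdim

variable (k : Type u) [Field k]

section Linear

variable {C : Type*} [Category* C] [Preadditive C] [Linear k C]

/-- An object `M` of a `k`-linear category is a brick if `Hom(M, M) = k`, that is, if
every endomorphism of `M` is a unique scalar multiple of the identity. -/
def IsBrick (M : C) : Prop :=
  Function.Bijective fun c : k => c • 𝟙 M

/-- A family of objects is a brick set if all members are bricks and
`dim Hom(Xᵢ, Xⱼ) = δᵢⱼ`. (In particular the members are pairwise non-isomorphic.) -/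
structure IsBrickSet {ι : Type*} (X : ι → C) : Prop where
  isBrick : ∀ i, IsBrick k (X i)
  rank_self : ∀ i, Module.rank k (X i ⟶ X i) = 1
  rank_of_ne : ∀ i j, i ≠ j → Module.rank k (X i ⟶ X j) = 0

end Linear

/-- The spectral radius of a square matrix with entries in `ℕ ∪ {∞}`: every infinite entry is
replaced by a real variable `x i j`, and one takes the limit inferior, as all `x i j → ∞`, of the
largest absolute value of a complex eigenvalue. For a matrix with finite entries this is the
usual spectral radius. -/
def matrixSpectralRadius {n : ℕ} (a : Matrix (Fin n) (Fin n) ℕ∞) : ℝ≥0∞ :=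
  liminf (fun x : Fin n → Fin n → ℝ =>
    spectralRadius ℂ (Matrix.of fun i j =>
      (((if a i j = ⊤ then x i j else ((a i j).toNat : ℝ)) : ℝ) : ℂ))) atTop

section Abelian

variable {C : Type v} [Category.{w} C] [Abelian C] [Linear k C]

/-- The adjacency matrix `(dim Ext¹(Xᵢ, Xⱼ))ᵢⱼ`, where `Ext¹` is that of the
abelian category `C`. -/
def extAdjacencyMatrix {n : ℕ} (X : Fin n → C) : Matrix (Fin n) (Fin n) ℕ∞ :=
  letI : HasExt.{max v w} C := HasExt.standard C
  Matrix.of fun i j => Cardinal.toENat (Module.rank k (Ext (X i) (X j) 1))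

variable (C)

/-- The `n`-th Frobenius-Perron dimension of the functor `Ext¹` of the abelian category `C`:
the supremum, over all brick sets with `n` members, of the spectral radius of the
adjacency matrix (`0` if there are none). -/
def fpdimN (n : ℕ) : ℝ≥0∞ :=
  ⨆ (X : Fin n → C) (_ : IsBrickSet k X), matrixSpectralRadius (extAdjacencyMatrix k X)

/-- The Frobenius-Perron dimension of the abelian category `C`. -/
def fpdim : ℝ≥0∞ :=
  ⨆ (n : ℕ) (_ : 1 ≤ n), fpdimN k C n

end Abelian

end FPdim

/-! ### Finite-dimensional modules, almost split sequences and the Auslander-Reiten translation -/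

section AuslanderReiten

variable (k : Type u) [Field k] {A : Type v} [Ring A] [Algebra k A]

/-- The `A`-modules which are finite-dimensional over `k`. -/
def finDimModules : ObjectProperty (ModuleCat.{v} A) :=
  fun M => Module.Finite k M

/-- Almost split sequences `0 → X₁ → X₂ → X₃ → 0` in the category of
finite-dimensional left `A`-modules. -/
structure IsAlmostSplit (S : ShortComplex (ModuleCat.{v} A)) : Prop where
  finDim₁ : finDimModules k S.X₁
  finDim₂ : finDimModules k S.X₂
  finDim₃ : finDimModules k S.X₃
  shortExact : S.ShortExact
  not_isSplitMono : ¬ IsSplitMono S.f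
  left : ∀ (Y : ModuleCat.{v} A) (h : S.X₁ ⟶ Y), finDimModules k Y → ¬ IsSplitMono h →
    ∃ h' : S.X₂ ⟶ Y, S.f ≫ h' = h
  not_isSplitEpi : ¬ IsSplitEpi S.g
  right : ∀ (Y : ModuleCat.{v} A) (h : Y ⟶ S.X₃), finDimModules k Y → ¬ IsSplitEpi h →
    ∃ h' : Y ⟶ S.X₂, h' ≫ S.g = h

/-- `L` is the Auslander-Reiten translate `τ N`: there is an almost split sequence
`0 → L → M → N → 0` of finite-dimensional modules. -/
def IsARTranslate (L N : ModuleCat.{v} A) : Prop :=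
  ∃ (M : ModuleCat.{v} A) (f : L ⟶ M) (g : M ⟶ N) (w : f ≫ g = 0),
    IsAlmostSplit k (ShortComplex.mk f g w)

end AuslanderReiten

/-! ### The extension category of a brick set is abelian -/

section ExtensionCategory

variable {k : Type u} [Field k] {A : Type v} [Ring A] [Algebra k A] {ι : Type w}
  {E : ι → ModuleCat.{v} A}

lemma IsBrickSet.nontrivial (h : IsBrickSet k E) (j : ι) : Nontrivial (E j) := by
  by_contra hn
  rw [not_nontrivial_iff_subsingleton] at hn
  have : (0 : k) = 1 := (h.isBrick j).1 (by
    ext x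
    exact Subsingleton.elim _ _)
  exact zero_ne_one this

lemma IsBrickSet.bijective_of_ne_zero (h : IsBrickSet k E) (i j : ι) (f : E i →ₗ[A] E j)
    (hf : f ≠ 0) : Function.Bijective f := by
  classical
  by_cases hij : i = j
  · subst hij
    obtain ⟨c, hc⟩ := (h.isBrick i).2 (ModuleCat.ofHom f)
    have hc0 : c ≠ 0 := by
      rintro rfl
      apply hf
      have h0 : ModuleCat.ofHom f = 0 := by rw [← hc]; simp
      exact congrArg ModuleCat.Hom.hom h0
    have : IsIso (ModuleCat.ofHom f) := by
      refine ⟨c⁻¹ • 𝟙 _, ?_, ?_⟩ <;> rw [← hc] <;> simp [smul_smul, hc0]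
    exact ConcreteCategory.bijective_of_isIso (ModuleCat.ofHom f)
  · have := h.rank_of_ne i j hij
    rw [rank_zero_iff] at this
    exact absurd (congrArg ModuleCat.Hom.hom (Subsingleton.elim (ModuleCat.ofHom f) 0)) hf

lemma extensionCategory_of_iso {M N : ModuleCat.{v} A} (e : M ≅ N)
    (h : extensionCategory E M) : extensionCategory E N :=
  h.imp fun _ hl => hl.congr e.toLinearEquiv

instance : (extensionCategory E).IsClosedUnderIsomorphisms where
  of_iso e h := extensionCategory_of_iso e h

instance : (extensionCategory E).ContainsZero where
  exists_zero := ⟨ModuleCat.of A PUnit, ModuleCat.isZero_of_subsingleton _,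
    0, hasFiltration_zero_iff.2 (inferInstanceAs (Subsingleton PUnit))⟩

lemma IsBrickSet.isClosedUnderKernels (h : IsBrickSet k E) :
    (extensionCategory E).IsClosedUnderKernels where
  kernels_le := by
    rintro _ ⟨f, c, hc, ⟨⟨l, hX⟩, ⟨m, hY⟩⟩⟩
    have := h.nontrivial
    obtain ⟨a, ha⟩ := (HasFiltration.ker_and_coker h.bijective_of_ne_zero hX hY f.hom).1
    exact extensionCategory_of_iso
      ((ModuleCat.kernelIsoKer f).symm ≪≫ (kernelIsKernel f).conePointUniqueUpToIso hc) ⟨a, ha⟩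

lemma IsBrickSet.isClosedUnderCokernels (h : IsBrickSet k E) :
    (extensionCategory E).IsClosedUnderCokernels where
  cokernels_le := by
    rintro _ ⟨f, c, hc, ⟨⟨l, hX⟩, ⟨m, hY⟩⟩⟩
    have := h.nontrivial
    obtain ⟨a, ha⟩ := (HasFiltration.ker_and_coker h.bijective_of_ne_zero hX hY f.hom).2
    exact extensionCategory_of_iso
      ((ModuleCat.cokernelIsoRangeQuotient f).symm ≪≫
        (cokernelIsCokernel f).coconePointUniqueUpToIso hc) ⟨a, ha⟩

lemma IsBrickSet.isClosedUnderFiniteProducts (h : IsBrickSet k E) :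
    (extensionCategory E).IsClosedUnderFiniteProducts := by
  have : (extensionCategory E).IsClosedUnderBinaryProducts := by
    refine ⟨?_⟩
    rintro X ⟨p⟩
    obtain ⟨a, ha⟩ := p.prop_diag_obj ⟨WalkingPair.left⟩
    obtain ⟨b, hb⟩ := p.prop_diag_obj ⟨WalkingPair.right⟩
    set M := p.diag.obj ⟨WalkingPair.left⟩
    set N := p.diag.obj ⟨WalkingPair.right⟩
    have := h.nontrivial
    have hMN : HasFiltration E (a + b) (M × N) := by
      refine HasFiltration.extension (LinearMap.snd A M N) LinearMap.snd_surjective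
        (ha.congr ?_) hb
      rw [LinearMap.ker_snd]
      exact LinearEquiv.ofInjective _ LinearMap.inl_injective
    let e : X ≅ M ⨯ N := IsLimit.conePointsIsoOfNatIso p.isLimit (limit.isLimit (pair M N))
      (diagramIsoPair p.diag)
    exact extensionCategory_of_iso
      ((ModuleCat.biprodIsoProd M N).symm ≪≫ biprod.isoProd M N ≪≫ e.symm) ⟨_, hMN⟩
  exact .mk'

/-- The extension category of a brick set is an abelian category (with the additive
structure inherited from the category of modules). -/
@[reducible]
def IsBrickSet.abelian (h : IsBrickSet k E) : Abelian (extensionCategory E).FullSubcategory :=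
  haveI := h.isClosedUnderKernels
  haveI := h.isClosedUnderCokernels
  haveI := h.isClosedUnderFiniteProducts
  inferInstance

end ExtensionCategory

end FP

end

/-! The Euler form `dim Hom - dim Ext¹` restricted to the extension category is that of a cyclic
quiver with `r` vertices, and that form is positive semidefinite.

The almost split sequence ending in `E i` forces `Ext¹(E i, E j)` to be one-dimensional for `j = i -
1` and zero otherwise (`IsBrickSet.finrank_ext_one`): a nonzero class is carried to the almost split
one by a map between bricks, hence by a scalar or by zero. Since `Ext²` vanishes on the family, `dim
Hom - dim Ext¹` is additive along filtrations, so a filtered module with multiplicities `x` paired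
with one with multiplicities `y` gives `∑ i, (x i * y i - x i * y (i - 1))`
(`IsBrickSet.exists_multiplicity`).

For a brick set the `Hom` matrix is the identity, so its `Ext¹` matrix is the identity minus a Gram
matrix of this form. Semidefiniteness gives `vᵀ m v ≤ vᵀ v` for all real `v`. As the entries of `m`
are nonnegative, every eigenvalue has absolute value at most one (`spectralRadius_le_one_of_gram`).
The bound is attained by the `E i` themselves, whose matrix is that of a cyclic permutation.

The dimension is defined through `Ext¹` of the extension category, whereas the hypotheses concern
modules. The two agree because the inclusion is exact, fully faithful and closed under extensions
(`IsBrickSet.toENat_rank_ext_one`). This rests on representing every degree one class by a short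
exact sequence (`exists_shortExact_extClass_eq`). -/

/-! ### Degree one extension groups of abelian categories -/

namespace CategoryTheory.Abelian.Ext

universe w' v' u'

variable {C : Type u} [Category.{v} C] [Abelian C]

open HomologicalComplex in
/-- A quasi-isomorphism from a complex in non-positive degrees to an object placed in degree `i`
restricts to an epimorphism on the component of degree `i`. -/
lemma _root_.CochainComplex.exists_epi_single_lift {X : C} {K : CochainComplex C ℤ} {i : ℤ}
    (π : K ⟶ (single C (ComplexShape.up ℤ) i).obj X) [K.IsStrictlyLE i] (hπ : QuasiIsoAt π i) :
    ∃ (Z : C) (p : Z ⟶ X) (_ : Epi p) (j : (single C (ComplexShape.up ℤ) i).obj Z ⟶ K),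
      j ≫ π = (single C (ComplexShape.up ℤ) i).map p := by
  -- Above degree `i` the complex vanishes, so every element of degree `i` is a cycle and `K.X i`
  -- maps onto the homology, which is `X` by the quasi-isomorphism. This composite is the required
  -- epimorphism.
  have hz : IsZero (K.X (i + 1)) := K.isZero_of_isStrictlyLE i (i + 1) (by simp)
  let e := K.iCyclesIso i (i + 1) (by simp) (hz.eq_of_tgt _ _)
  let α : K.X i ⟶ X :=
    e.inv ≫ K.homologyπ i ≫ homologyMap π i ≫ (singleObjHomologySelfIso _ _ _).hom
  have hα : π.f i = α ≫ (singleObjXSelf (ComplexShape.up ℤ) i X).inv := by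
    rw [← cancel_epi e.hom]
    dsimp only [α, e]
    rw [Category.assoc, Category.assoc, Category.assoc, Iso.hom_inv_id_assoc,
      homologyπ_naturality_assoc, homologyπ_singleObjHomologySelfIso_hom_assoc,
      ← singleObjCyclesSelfIso_inv_iCycles, Iso.hom_inv_id_assoc]
    exact (cyclesMap_i π i).symm
  have : IsIso (homologyMap π i) := (quasiIsoAt_iff_isIso_homologyMap π i).1 hπ
  have hepi : Epi α := by
    dsimp only [α]
    infer_instance
  have hd : ∀ k, (ComplexShape.up ℤ).Rel i k → 𝟙 (K.X i) ≫ K.d i k = 0 := by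
    intro k hk
    obtain rfl : i + 1 = k := hk
    exact hz.eq_of_tgt _ _
  refine ⟨K.X i, α, hepi, mkHomFromSingle (𝟙 _) hd, ?_⟩
  apply HomologicalComplex.from_single_hom_ext
  rw [comp_f, mkHomFromSingle_f, Category.assoc, hα, single_map_f_self, Category.id_comp]

/-- Extension classes of degree one are effaceable. -/
lemma exists_epi_comp_eq_zero [HasExt.{w'} C] {X Y : C} (x : Ext X Y 1) :
    ∃ (Z : C) (p : Z ⟶ X) (_ : Epi p), (mk₀ p).comp x (zero_add 1) = 0 := by
  let := HasDerivedCategory.standard C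
  -- `Y[1]` is rewritten as `Y` placed in degree `-1`, so that `x` becomes a roof out of a complex
  -- `K` living in degrees at most `0`.
  let t := ((DerivedCategory.singleFunctors C).shiftIso 1 (-1) 0 (by lia)).hom.app Y
  obtain ⟨K, _, π, h, g, hg⟩ := DerivedCategory.right_fac_of_isStrictlyLE
    (X := (CochainComplex.singleFunctor C 0).obj X)
    (Y := (CochainComplex.singleFunctor C (-1)).obj Y) (x.hom ≫ t) 0
  have hq : QuasiIso π := by
    rwa [DerivedCategory.isIso_Q_map_iff_quasiIso] at h
  obtain ⟨Z, p, hp, j, hj⟩ := CochainComplex.exists_epi_single_lift π (hq.quasiIsoAt 0)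
  refine ⟨Z, p, hp, ?_⟩
  -- The source is concentrated in degree `0` and the target in degree `-1`, so the composite
  -- vanishes already as a map of complexes.
  have h0 : j ≫ g = 0 := by
    apply HomologicalComplex.from_single_hom_ext
    apply (((CochainComplex.singleFunctor C (-1)).obj Y).isZero_of_isStrictlyLE
      (-1) 0 (by lia)).eq_of_tgt
  have hjg : DerivedCategory.Q.map j ≫ DerivedCategory.Q.map g = 0 := by
    rw [← DerivedCategory.Q.map_comp, h0, DerivedCategory.Q.map_zero]
  have h1 : DerivedCategory.Q.map j ≫ DerivedCategory.Q.map π =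
      (DerivedCategory.singleFunctor C 0).map p := by
    rw [← DerivedCategory.Q.map_comp]
    exact congrArg DerivedCategory.Q.map hj
  have hcancel : ∀ {U₁ U₂ U₃ U₄ : DerivedCategory C} (a : U₁ ⟶ U₂) (b : U₂ ⟶ U₃) (_ : IsIso b)
      (c : U₂ ⟶ U₄), a ≫ c = 0 → (a ≫ b) ≫ inv b ≫ c = 0 := by
    intro _ _ _ _ a b _ c hac
    simp [hac]
  ext
  rw [← singleFunctor_map_comp_hom, ← cancel_mono t, Category.assoc]
  refine (congrArg (fun z => (DerivedCategory.singleFunctor C 0).map p ≫ z) hg).trans ?_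
  rw [← h1, zero_hom, Limits.zero_comp]
  exact hcancel _ _ h _ hjg

/-- Every extension class of degree one is the class of a short exact sequence. -/
lemma exists_shortExact_extClass_eq [HasExt.{w'} C] {X Y : C} (x : Ext X Y 1) :
    ∃ (Z : C) (f : Y ⟶ Z) (g : Z ⟶ X) (w : f ≫ g = 0)
      (hS : (ShortComplex.mk f g w).ShortExact), hS.extClass = x := by
  obtain ⟨Z, p, hp, hx⟩ := exists_epi_comp_eq_zero x
  have hT : (ShortComplex.mk _ _ (kernel.condition p)).ShortExact :=
    { exact := ShortComplex.exact_kernel p }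
  -- Since `p` kills `x`, the class comes from a morphism `h : kernel p ⟶ Y`. The extension sought
  -- is the pushout along `h` of the sequence given by `p`.
  obtain ⟨x₁, rfl⟩ := contravariant_sequence_exact₃ hT Y x hx (add_zero 1)
  obtain ⟨h, rfl⟩ := (mk₀_bijective _ _).2 x₁
  let q : pushout (kernel.ι p) h ⟶ X := pushout.desc p 0 (by simp)
  have hq : pushout.inr (kernel.ι p) h ≫ q = 0 := pushout.inr_desc _ _ _
  have hq' : pushout.inl (kernel.ι p) h ≫ q = p := pushout.inl_desc _ _ _
  have : Epi q := by
    have : Epi (pushout.inl (kernel.ι p) h ≫ q) := by rw [hq']; exact hp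
    exact epi_of_epi (pushout.inl (kernel.ι p) h) q
  have hS : (ShortComplex.mk (pushout.inr (kernel.ι p) h) q hq).ShortExact := by
    have : Mono (ShortComplex.mk (pushout.inr (kernel.ι p) h) q hq).f :=
      inferInstanceAs (Mono (pushout.inr (kernel.ι p) h))
    have : Epi (ShortComplex.mk (pushout.inr (kernel.ι p) h) q hq).g := ‹Epi q›
    refine { exact := ?_ }
    refine ShortComplex.exact_of_g_is_cokernel _ (CokernelCofork.IsColimit.ofπ' _ _ ?_)
    intro A k hk
    have hk' : pushout.inr (kernel.ι p) h ≫ k = 0 := hk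
    have hk₂ : kernel.ι p ≫ pushout.inl (kernel.ι p) h ≫ k = 0 := by
      rw [pushout.condition_assoc, hk', Limits.comp_zero]
    -- A map out of the pushout that kills `Y` restricts along `pushout.inl` to a map killing
    -- `kernel p`, hence factors through `p`. So `q` is a cokernel of `pushout.inr`.
    refine ⟨hT.gIsCokernel.desc (CokernelCofork.ofπ _ hk₂), ?_⟩
    have hd : p ≫ hT.gIsCokernel.desc (CokernelCofork.ofπ _ hk₂) =
        pushout.inl (kernel.ι p) h ≫ k :=
      Cofork.IsColimit.π_desc hT.gIsCokernel
    apply pushout.hom_ext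
    · dsimp
      rw [reassoc_of% hq', hd]
    · dsimp
      rw [reassoc_of% hq, Limits.zero_comp, hk']
  refine ⟨_, _, _, _, hS, ?_⟩
  let φ : ShortComplex.mk _ _ (kernel.condition p) ⟶
      ShortComplex.mk (pushout.inr (kernel.ι p) h) q hq :=
    { τ₁ := h
      τ₂ := pushout.inl (kernel.ι p) h
      τ₃ := 𝟙 X
      comm₁₂ := pushout.condition.symm
      comm₂₃ := by simp [hq'] }
  have := ShortComplex.ShortExact.extClass_naturality hT hS φ
  rw [this]
  simp [φ]

lemma extClass_eq_zero_iff_isSplitEpi [HasExt.{w'} C] {S : ShortComplex C} (hS : S.ShortExact) :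
    hS.extClass = 0 ↔ IsSplitEpi S.g := by
  constructor
  · intro h
    -- The class is the image of the identity of `S.X₃` under the connecting map. Its vanishing
    -- lifts the identity through `S.g`, which is a section.
    obtain ⟨x₂, hx₂⟩ := covariant_sequence_exact₃ S.X₃ hS (mk₀ (𝟙 S.X₃)) (zero_add 1) (by simp [h])
    obtain ⟨s, rfl⟩ := (mk₀_bijective _ _).2 x₂
    rw [mk₀_comp_mk₀] at hx₂
    exact ⟨⟨⟨s, (mk₀_bijective _ _).1 hx₂⟩⟩⟩
  · rintro ⟨⟨s, hs⟩⟩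
    have h : hS.extClass = (mk₀ (s ≫ S.g)).comp hS.extClass (zero_add 1) := by simp [hs]
    rw [h, ← mk₀_comp_mk₀_assoc, hS.comp_extClass, comp_zero]

/-! ### Comparison of `Ext¹` along fully faithful exact functors -/

section ExactFunctor

variable {D : Type u'} [Category.{v'} D] [Abelian D] [HasExt.{w} C] [HasExt.{w'} D]
  (F : C ⥤ D) [F.Additive] [PreservesFiniteLimits F] [PreservesFiniteColimits F]

/-- Fully faithful exact functors are injective on `Ext¹`. -/
lemma mapExactFunctor_one_injective [F.Full] [F.Faithful] (X Y : C) :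
    Function.Injective (F.mapExtAddHom X Y 1) := by
  rw [injective_iff_map_eq_zero]
  intro x hx
  obtain ⟨Z, f, g, w, hS, rfl⟩ := exists_shortExact_extClass_eq x
  rw [Functor.mapExtAddHom_apply, mapExactFunctor_extClass] at hx
  have := (extClass_eq_zero_iff_isSplitEpi (hS.map_of_exact F)).1 hx
  rw [extClass_eq_zero_iff_isSplitEpi]
  exact (F.isSplitEpi_iff g).1 this

/-- Fully faithful exact functors whose image is closed under extensions are surjective on
`Ext¹`. -/
lemma mapExactFunctor_one_surjective [F.Full] [F.Faithful] (X Y : C)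
    (h : ∀ S : ShortComplex D, S.ShortExact → S.X₁ = F.obj Y → S.X₃ = F.obj X →
      ∃ Z, F.obj Z = S.X₂) :
    Function.Surjective (F.mapExtAddHom X Y 1) := by
  intro x
  obtain ⟨Z, f, g, w, hS, rfl⟩ := exists_shortExact_extClass_eq x
  obtain ⟨Z, rfl⟩ := h _ hS rfl rfl
  obtain ⟨f, rfl⟩ := F.map_surjective f
  obtain ⟨g, rfl⟩ := F.map_surjective g
  have w' : f ≫ g = 0 := F.map_injective (by simpa using w)
  have hT : (ShortComplex.mk f g w').ShortExact :=
    ShortExact.reflects_shortExact_of_faithful F hS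
  exact ⟨hT.extClass, mapExactFunctor_extClass F hT⟩

end ExactFunctor

end CategoryTheory.Abelian.Ext

/-! ### Spectral radii of matrices of natural numbers -/

namespace FP

/-- No entry is infinite, so the function under the limit inferior does not depend on the variables.
-/
lemma matrixSpectralRadius_natCast {n : ℕ} (m : Matrix (Fin n) (Fin n) ℕ) :
    matrixSpectralRadius (m.map ((↑) : ℕ → ℕ∞)) =
      spectralRadius ℂ (m.map ((↑) : ℕ → ℂ)) := by
  have h : ∀ x : Fin n → Fin n → ℝ, (Matrix.of fun i j =>
      (((if (m.map ((↑) : ℕ → ℕ∞)) i j = ⊤ then x i j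
        else (((m.map ((↑) : ℕ → ℕ∞)) i j).toNat : ℝ)) : ℝ) : ℂ)) = m.map ((↑) : ℕ → ℂ) := by
    intro x
    ext i j
    simp
  unfold matrixSpectralRadius
  simp_rw [h]
  exact liminf_const _

/-- A matrix with nonnegative entries whose quadratic form is bounded by the standard one has
spectral radius at most one. -/
lemma spectralRadius_le_one_of_quadratic {n : ℕ} (m : Matrix (Fin n) (Fin n) ℕ)
    (h : ∀ v : Fin n → ℝ, ∑ s, ∑ t, v s * m s t * v t ≤ ∑ s, v s ^ 2) :
    spectralRadius ℂ (m.map ((↑) : ℕ → ℂ)) ≤ 1 := by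
  refine iSup₂_le fun z hz => ?_
  rw [← Matrix.spectrum_toLin', ← Module.End.hasEigenvalue_iff_mem_spectrum] at hz
  obtain ⟨v, hv⟩ := hz.exists_hasEigenvector
  have hvz : ∀ s, ∑ t, (m s t : ℂ) * v t = z * v s := by
    intro s
    have := congrFun hv.apply_eq_smul s
    simpa [Matrix.toLin'_apply, Matrix.mulVec, dotProduct] using this
  have hpos : 0 < ∑ s, ‖v s‖ ^ 2 := by
    obtain ⟨s, hs⟩ := Function.ne_iff.1 hv.2
    exact Finset.sum_pos' (fun _ _ => by positivity) ⟨s, Finset.mem_univ _, by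
      have : 0 < ‖v s‖ := norm_pos_iff.2 hs
      positivity⟩
  have hle : ‖z‖ * ∑ s, ‖v s‖ ^ 2 ≤ ∑ s, ‖v s‖ ^ 2 := by
    -- The quadratic bound is applied to the vector of absolute values of an eigenvector. The
    -- entries of `m` being nonnegative, the triangle inequality goes the right way, and no symmetry
    -- of `m` is needed.
    refine le_trans ?_ (h fun s => ‖v s‖)
    rw [Finset.mul_sum]
    refine Finset.sum_le_sum fun s _ => ?_
    calc ‖z‖ * ‖v s‖ ^ 2 = ‖v s‖ * ‖z * v s‖ := by rw [norm_mul]; ring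
      _ = ‖v s‖ * ‖∑ t, (m s t : ℂ) * v t‖ := by rw [hvz]
      _ ≤ ‖v s‖ * ∑ t, (m s t : ℝ) * ‖v t‖ := by
        gcongr
        refine (norm_sum_le _ _).trans (le_of_eq ?_)
        simp
      _ = ∑ t, ‖v s‖ * m s t * ‖v t‖ := by
        rw [Finset.mul_sum]
        exact Finset.sum_congr rfl fun t _ => by ring
  have hz1 : ‖z‖ ≤ 1 := by nlinarith
  exact_mod_cast hz1

/-- If all row sums of a nonempty matrix are `1`, then its spectral radius is at least one. -/
lemma one_le_spectralRadius_of_row_sum {n : ℕ} [NeZero n] (m : Matrix (Fin n) (Fin n) ℕ)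
    (h : ∀ s, ∑ t, m s t = 1) :
    1 ≤ spectralRadius ℂ (m.map ((↑) : ℕ → ℂ)) := by
  have h1 : (1 : ℂ) ∈ spectrum ℂ (m.map ((↑) : ℕ → ℂ)) := by
    rw [← Matrix.spectrum_toLin', ← Module.End.hasEigenvalue_iff_mem_spectrum]
    refine Module.End.hasEigenvalue_of_hasEigenvector (x := fun _ => 1) ⟨?_, ?_⟩
    · rw [Module.End.mem_eigenspace_iff]
      ext s
      have := congrArg ((↑) : ℕ → ℂ) (h s)
      simpa [Matrix.toLin'_apply, Matrix.mulVec, dotProduct] using this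
    · exact fun h0 => one_ne_zero (congrFun h0 (0 : Fin n))
  have := le_iSup₂ (f := fun (z : ℂ) (_ : z ∈ spectrum ℂ (m.map ((↑) : ℕ → ℂ))) =>
    (‖z‖₊ : ℝ≥0∞)) 1 h1
  simpa [spectralRadius] using this

/-- The Euler form of a cyclic quiver is positive semidefinite. -/
lemma sum_mul_le_sum_sq {ι : Type*} [Fintype ι] (σ : Equiv.Perm ι) (w : ι → ℝ) :
    ∑ i, w i * w (σ i) ≤ ∑ i, w i ^ 2 := by
  have h1 : ∑ i, w (σ i) ^ 2 = ∑ i, w i ^ 2 := Equiv.sum_comp σ fun i => w i ^ 2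
  have h2 : ∑ i, w i * w (σ i) ≤ ∑ i, (w i ^ 2 + w (σ i) ^ 2) / 2 :=
    Finset.sum_le_sum fun i _ => by nlinarith [sq_nonneg (w i - w (σ i))]
  rw [← Finset.sum_div, Finset.sum_add_distrib, h1] at h2
  linarith

/-- If a matrix of natural numbers is the difference of the identity matrix and a Gram matrix for
the Euler form of a cyclic quiver, then its spectral radius is at most one. -/
lemma spectralRadius_le_one_of_gram {ι : Type*} [Fintype ι] (σ : Equiv.Perm ι) {n : ℕ}
    (m : Matrix (Fin n) (Fin n) ℕ) (x : Fin n → ι → ℕ)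
    (h : ∀ s t, (m s t : ℤ) = (if s = t then 1 else 0) -
      ∑ i, ((x s i : ℤ) * x t i - x s i * x t (σ i))) :
    spectralRadius ℂ (m.map ((↑) : ℕ → ℂ)) ≤ 1 := by
  refine spectralRadius_le_one_of_quadratic m fun v => ?_
  -- By bilinearity the Gram part of the form at `v` is the cyclic Euler form evaluated at the
  -- single vector `W`.
  let W : ι → ℝ := fun i => ∑ s, v s * x s i
  have hm : ∀ s t, (m s t : ℝ) = (if s = t then 1 else 0) -
      ∑ i, ((x s i : ℝ) * x t i - x s i * x t (σ i)) := by
    intro s t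
    have := congrArg ((↑) : ℤ → ℝ) (h s t)
    push_cast at this
    exact this
  -- Used twice: `τ = id` for the diagonal part of the Euler form and `τ = σ` for the arrows.
  have hW : ∀ τ : ι → ι, ∑ s, ∑ t, ∑ i, v s * v t * ((x s i : ℝ) * x t (τ i)) =
      ∑ i, W i * W (τ i) := by
    intro τ
    simp only [W, Finset.sum_mul_sum]
    simp_rw [Finset.sum_comm (s := Finset.univ (α := Fin n)) (t := Finset.univ (α := ι))]
    refine Finset.sum_congr rfl fun i _ => Finset.sum_congr rfl fun s _ =>
      Finset.sum_congr rfl fun t _ => by ring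
  have hexp : ∑ s, ∑ t, v s * m s t * v t =
      ∑ s, v s ^ 2 - (∑ i, W i * W i - ∑ i, W i * W (σ i)) := by
    rw [show ∑ i, W i * W i = _ from (hW id).symm, ← hW σ]
    have : ∑ s, v s ^ 2 = ∑ s, ∑ t, v s * (if s = t then 1 else 0) * v t := by
      refine Finset.sum_congr rfl fun s _ => ?_
      simp [sq]
    rw [this]
    simp only [← Finset.sum_sub_distrib]
    refine Finset.sum_congr rfl fun s _ => Finset.sum_congr rfl fun t _ => ?_
    rw [hm, mul_sub, sub_mul, Finset.mul_sum, Finset.sum_mul]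
    congr 1
    refine Finset.sum_congr rfl fun i _ => ?_
    simp only [id]
    ring
  have := sum_mul_le_sum_sq σ W
  simp only [sq] at this ⊢
  simp only [sq] at hexp
  rw [hexp]
  linarith

end FP

/-! ### The Euler form -/

lemma Module.Finite.of_exact_of_finite {k U V W : Type*} [Field k] [AddCommGroup U]
    [AddCommGroup V] [AddCommGroup W] [Module k U] [Module k V] [Module k W]
    {f : U →ₗ[k] V} {g : V →ₗ[k] W} (hfg : Function.Exact f g)
    [Module.Finite k U] [Module.Finite k W] : Module.Finite k V := by
  have : Module.Finite k (LinearMap.ker g) := by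
    rw [LinearMap.exact_iff.1 hfg]; infer_instance
  have : Module.Finite k (V ⧸ LinearMap.ker g) := Module.Finite.equiv g.quotKerEquivRange.symm
  exact Module.Finite.of_submodule_quotient (LinearMap.ker g)

/-- The alternating sum of dimensions in a six term exact sequence. -/
lemma Module.finrank_sixTerm {k : Type*} [Field k] {V₀ V₁ V₂ V₃ V₄ V₅ : Type*}
    [AddCommGroup V₀] [AddCommGroup V₁] [AddCommGroup V₂] [AddCommGroup V₃] [AddCommGroup V₄]
    [AddCommGroup V₅] [Module k V₀] [Module k V₁] [Module k V₂] [Module k V₃] [Module k V₄]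
    [Module k V₅] {f₀ : V₀ →ₗ[k] V₁} {f₁ : V₁ →ₗ[k] V₂} {f₂ : V₂ →ₗ[k] V₃} {f₃ : V₃ →ₗ[k] V₄}
    {f₄ : V₄ →ₗ[k] V₅} (h₀ : Function.Injective f₀) (h₁ : Function.Exact f₀ f₁)
    (h₂ : Function.Exact f₁ f₂) (h₃ : Function.Exact f₂ f₃) (h₄ : Function.Exact f₃ f₄)
    (h₅ : Function.Surjective f₄) [Module.Finite k V₀] [Module.Finite k V₂] [Module.Finite k V₃]
    [Module.Finite k V₅] :
    Module.Finite k V₁ ∧ Module.Finite k V₄ ∧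
      (Module.finrank k V₁ : ℤ) - Module.finrank k V₄ =
        ((Module.finrank k V₀ : ℤ) - Module.finrank k V₃) +
          ((Module.finrank k V₂ : ℤ) - Module.finrank k V₅) := by
  have := Module.Finite.of_exact_of_finite h₁
  have := Module.Finite.of_exact_of_finite h₄
  refine ⟨inferInstance, inferInstance, ?_⟩
  have e₀ := LinearMap.finrank_range_of_inj h₀
  have e₁ := f₁.finrank_range_add_finrank_ker
  have e₂ := f₂.finrank_range_add_finrank_ker
  have e₃ := f₃.finrank_range_add_finrank_ker
  have e₄ := f₄.finrank_range_add_finrank_ker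
  rw [LinearMap.exact_iff.1 h₁] at e₁
  rw [LinearMap.exact_iff.1 h₂] at e₂
  rw [LinearMap.exact_iff.1 h₃] at e₃
  rw [LinearMap.exact_iff.1 h₄, LinearMap.range_eq_top.2 h₅, finrank_top] at e₄
  omega

namespace FP

section EulerForm

variable (k : Type u) [Field k] {C : Type*} [Category.{v} C] [Abelian C] [Linear k C] [HasExt.{w} C]

/-- The groups `Hom(X, Y)` and `Ext¹(X, Y)` are finite-dimensional and `Ext²(X, Y) = 0`. -/
structure IsEulerPair (X Y : C) : Prop where
  finite_zero : Module.Finite k (Ext X Y 0)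
  finite_one : Module.Finite k (Ext X Y 1)
  subsingleton_two : Subsingleton (Ext X Y 2)

/-- The Euler form `dim Hom(X, Y) - dim Ext¹(X, Y)`. -/
noncomputable def eulerForm (X Y : C) : ℤ :=
  Module.finrank k (Ext X Y 0) - Module.finrank k (Ext X Y 1)

variable {k}

lemma exact_of_addCommGrpCat {S : ShortComplex AddCommGrpCat.{w}} (hS : S.Exact) :
    Function.Exact S.f S.g :=
  (ShortComplex.ab_exact_iff_function_exact _).1 hS

/-- The vanishing of `Ext²(S.X₃, Y)` cuts the long exact sequence down to six terms, whose
alternating sum of dimensions is zero. `Ext²(S.X₂, Y)` vanishes, being squeezed between two zero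
groups. -/
lemma IsEulerPair.of_shortExact_left {S : ShortComplex C} (hS : S.ShortExact) {Y : C}
    (h₁ : IsEulerPair k S.X₁ Y) (h₃ : IsEulerPair k S.X₃ Y) :
    IsEulerPair k S.X₂ Y ∧ eulerForm k S.X₂ Y = eulerForm k S.X₁ Y + eulerForm k S.X₃ Y := by
  have := hS.epi_g
  have := h₁.finite_zero
  have := h₁.finite_one
  have := h₃.finite_zero
  have := h₃.finite_one
  have hsurj : Function.Surjective
      ((Ext.mk₀ S.f).precompOfLinear k Y (zero_add 1)) := fun x =>
    Ext.contravariant_sequence_exact₁ hS Y x rfl (h₃.subsingleton_two.elim _ _)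
  obtain ⟨f₂, f₁, h⟩ := Module.finrank_sixTerm
    (f₀ := (Ext.mk₀ S.g).precompOfLinear k Y (zero_add 0))
    (f₁ := (Ext.mk₀ S.f).precompOfLinear k Y (zero_add 0))
    (f₂ := hS.extClass.precompOfLinear k Y (add_zero 1))
    (f₃ := (Ext.mk₀ S.g).precompOfLinear k Y (zero_add 1))
    (f₄ := (Ext.mk₀ S.f).precompOfLinear k Y (zero_add 1))
    (Ext.precomp_mk₀_injective_of_epi Y S.g)
    (exact_of_addCommGrpCat (Ext.contravariant_sequence_exact₂' hS Y 0))
    (exact_of_addCommGrpCat (Ext.contravariant_sequence_exact₁' hS Y 0 1 rfl))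
    (exact_of_addCommGrpCat (Ext.contravariant_sequence_exact₃' hS Y 0 1 rfl))
    (exact_of_addCommGrpCat (Ext.contravariant_sequence_exact₂' hS Y 1)) hsurj
  refine ⟨⟨f₂, f₁, subsingleton_of_forall_eq 0 fun x => ?_⟩, by unfold eulerForm; linarith⟩
  obtain ⟨y, rfl⟩ := Ext.contravariant_sequence_exact₂ hS Y x (h₁.subsingleton_two.elim _ _)
  rw [h₃.subsingleton_two.elim y 0, Ext.comp_zero]

/-- Dual argument: here `Ext²(X, S.X₁) = 0` ends the six-term sequence. -/
lemma IsEulerPair.of_shortExact_right {S : ShortComplex C} (hS : S.ShortExact) {X : C}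
    (h₁ : IsEulerPair k X S.X₁) (h₃ : IsEulerPair k X S.X₃) :
    IsEulerPair k X S.X₂ ∧ eulerForm k X S.X₂ = eulerForm k X S.X₁ + eulerForm k X S.X₃ := by
  have := hS.mono_f
  have := h₁.finite_zero
  have := h₁.finite_one
  have := h₃.finite_zero
  have := h₃.finite_one
  have hsurj : Function.Surjective
      ((Ext.mk₀ S.g).postcompOfLinear k X (add_zero 1)) := fun x =>
    Ext.covariant_sequence_exact₃ X hS x rfl (h₁.subsingleton_two.elim _ _)
  obtain ⟨f₂, f₁, h⟩ := Module.finrank_sixTerm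
    (f₀ := (Ext.mk₀ S.f).postcompOfLinear k X (add_zero 0))
    (f₁ := (Ext.mk₀ S.g).postcompOfLinear k X (add_zero 0))
    (f₂ := hS.extClass.postcompOfLinear k X (zero_add 1))
    (f₃ := (Ext.mk₀ S.f).postcompOfLinear k X (add_zero 1))
    (f₄ := (Ext.mk₀ S.g).postcompOfLinear k X (add_zero 1))
    (Ext.postcomp_mk₀_injective_of_mono X S.f)
    (exact_of_addCommGrpCat (Ext.covariant_sequence_exact₂' X hS 0))
    (exact_of_addCommGrpCat (Ext.covariant_sequence_exact₃' X hS 0 1 rfl))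
    (exact_of_addCommGrpCat (Ext.covariant_sequence_exact₁' X hS 0 1 rfl))
    (exact_of_addCommGrpCat (Ext.covariant_sequence_exact₂' X hS 1)) hsurj
  refine ⟨⟨f₂, f₁, subsingleton_of_forall_eq 0 fun x => ?_⟩, by unfold eulerForm; linarith⟩
  obtain ⟨y, rfl⟩ := Ext.covariant_sequence_exact₂ X hS x (h₃.subsingleton_two.elim _ _)
  rw [h₁.subsingleton_two.elim y 0, Ext.zero_comp]

lemma isEulerPair_of_subsingleton {X Y : C} (h : ∀ n, Subsingleton (Ext X Y n)) :
    IsEulerPair k X Y ∧ eulerForm k X Y = 0 :=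
  have := h 0
  have := h 1
  ⟨⟨inferInstance, inferInstance, h 2⟩, by
    simp [eulerForm, Module.finrank_zero_of_subsingleton]⟩

lemma subsingleton_ext_of_isZero_left {X : C} (hX : IsZero X) (Y : C) (n : ℕ) :
    Subsingleton (Ext X Y n) := by
  refine subsingleton_of_forall_eq 0 fun x => ?_
  rw [← Ext.mk₀_id_comp x, hX.eq_of_src (𝟙 X) 0, Ext.mk₀_zero, Ext.zero_comp]

lemma subsingleton_ext_of_isZero_right (X : C) {Y : C} (hY : IsZero Y) (n : ℕ) :
    Subsingleton (Ext X Y n) := by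
  refine subsingleton_of_forall_eq 0 fun x => ?_
  rw [← Ext.comp_mk₀_id x, hY.eq_of_src (𝟙 Y) 0, Ext.mk₀_zero, Ext.comp_zero]

end EulerForm

/-! ### Additivity of the Euler form along filtrations -/

section Filtered

variable {k : Type u} [Field k] {A : Type v} [Ring A] [Algebra k A] {ι : Type w} [Fintype ι]
  {E : ι → ModuleCat.{v} A}

lemma shortExact_of_surjective {M N : ModuleCat.{v} A} (g : M →ₗ[A] N)
    (hg : Function.Surjective g) :
    (ShortComplex.mk (ModuleCat.ofHom (LinearMap.ker g).subtype) (ModuleCat.ofHom g)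
      (by ext x; exact x.2)).ShortExact := by
  refine ModuleCat.shortComplex_shortExact _ ?_ (Submodule.injective_subtype _) hg
  intro x
  simp

/-- The Euler form of a filtered module with an arbitrary module, in either order, is determined
by the multiplicities in the filtration. -/
lemma HasFiltration.exists_multiplicity :
    ∀ {l : ℕ} {M : ModuleCat.{v} A} (_ : HasFiltration E l M), ∃ x : ι → ℕ,
      (∀ Y : ModuleCat.{v} A, (∀ j, IsEulerPair k (E j) Y) →
        IsEulerPair k M Y ∧ eulerForm k M Y = ∑ i, x i * eulerForm k (E i) Y) ∧
      (∀ X : ModuleCat.{v} A, (∀ j, IsEulerPair k X (E j)) →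
        IsEulerPair k X M ∧ eulerForm k X M = ∑ i, x i * eulerForm k X (E i)) := by
  classical
  intro l
  induction l with
  | zero =>
    intro M hM
    rw [hasFiltration_zero_iff] at hM
    have hM' : IsZero M := ModuleCat.isZero_of_subsingleton M
    refine ⟨0, fun Y _ => ?_, fun X _ => ?_⟩
    · simpa using isEulerPair_of_subsingleton (subsingleton_ext_of_isZero_left hM' Y)
    · simpa using isEulerPair_of_subsingleton (subsingleton_ext_of_isZero_right X hM')
  | succ l ih =>
    intro M hM
    obtain ⟨j, g, hg, hK⟩ := hM.exists_of_succ
    obtain ⟨x, hx₁, hx₂⟩ := ih (M := ModuleCat.of A (LinearMap.ker g)) hK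
    have hS := shortExact_of_surjective g hg
    -- The top factor `E j` adds one at `j`. The vector is fixed before `Y` and `X` are, so the same
    -- multiplicities serve for both arguments of the form.
    refine ⟨x + Pi.single j 1, fun Y hY => ?_, fun X hX => ?_⟩
    · obtain ⟨h, he⟩ := hx₁ Y hY
      obtain ⟨h', he'⟩ := IsEulerPair.of_shortExact_left hS h (hY j)
      refine ⟨h', he'.trans ?_⟩
      simp only [Pi.add_apply, Nat.cast_add, add_mul, Finset.sum_add_distrib]
      simpa [Pi.single_apply] using he
    · obtain ⟨h, he⟩ := hx₂ X hX
      obtain ⟨h', he'⟩ := IsEulerPair.of_shortExact_right hS h (hX j)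
      refine ⟨h', he'.trans ?_⟩
      simp only [Pi.add_apply, Nat.cast_add, add_mul, Finset.sum_add_distrib]
      simpa [Pi.single_apply] using he

end Filtered

end FP

/-! ### Almost split sequences and extension groups of bricks -/

namespace FP

section AlmostSplit

variable {k : Type u} [Field k] {A : Type v} [Ring A] [Algebra k A]

lemma finDimModules_of_shortExact {S : ShortComplex (ModuleCat.{v} A)} (hS : S.ShortExact)
    (h₁ : finDimModules k S.X₁) (h₃ : finDimModules k S.X₃) : finDimModules k S.X₂ := by
  have : Module.Finite k S.X₁ := h₁
  have : Module.Finite k S.X₃ := h₃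
  exact Module.Finite.of_exact_of_finite (f := S.f.hom.restrictScalars k)
    (g := S.g.hom.restrictScalars k) 
      ((ShortComplex.ShortExact.moduleCat_exact_iff_function_exact S).1 hS.exact)

/-- Every nonzero extension of the end term of an almost split sequence by a finite-dimensional
module is mapped to the almost split sequence by some morphism. -/
lemma IsARTranslate.exists_ext {L X : ModuleCat.{v} A} (h : IsARTranslate k L X) :
    ∃ α : Ext X L 1, α ≠ 0 ∧ ∀ N : ModuleCat.{v} A, finDimModules k N →
      ∀ ξ : Ext X N 1, ξ ≠ 0 → ∃ f : N ⟶ L, ξ.comp (Ext.mk₀ f) (add_zero 1) = α := by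
  obtain ⟨M, f, g, w, hS⟩ := h
  refine ⟨hS.shortExact.extClass, fun h0 => hS.not_isSplitEpi
    ((Ext.extClass_eq_zero_iff_isSplitEpi _).1 h0), fun N hN ξ hξ => ?_⟩
  obtain ⟨Z, a, b, w', hT, rfl⟩ := Ext.exists_shortExact_extClass_eq ξ
  have hZ : finDimModules k Z := finDimModules_of_shortExact hT hN hS.finDim₃
  -- As `ξ` is nonzero, `b` is not a split epimorphism, so it lifts through `g`. The map `d` that
  -- the lift induces on kernels pushes `ξ` forward to the almost split class.
  obtain ⟨c, hc⟩ := hS.right Z b hZ fun hb => hξ ((Ext.extClass_eq_zero_iff_isSplitEpi hT).2 hb)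
  dsimp at c hc
  have hcw : (a ≫ c) ≫ g = 0 := by rw [Category.assoc, hc, w']
  have := hS.shortExact.mono_f
  let d : N ⟶ L := hS.shortExact.exact.lift (a ≫ c) hcw
  have hd : d ≫ f = a ≫ c := hS.shortExact.exact.lift_f _ _
  let φ : ShortComplex.mk a b w' ⟶ ShortComplex.mk f g w :=
    { τ₁ := d
      τ₂ := c
      τ₃ := 𝟙 X
      comm₁₂ := hd
      comm₂₃ := by simpa using hc }
  refine ⟨d, ?_⟩
  have := ShortComplex.ShortExact.extClass_naturality hT hS.shortExact φ
  refine this.trans ?_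
  simp [φ]

variable {ι : Type w} {E : ι → ModuleCat.{v} A}

/-- The dimensions of the extension groups between bricks, if the Auslander-Reiten translate of
one of them belongs to the same brick set. -/
lemma IsBrickSet.finrank_ext_one [DecidableEq ι] (hE : IsBrickSet k E) {i i' j : ι}
    (hfd : finDimModules k (E j)) (h : IsARTranslate k (E i') (E i)) :
    Module.Finite k (Ext (E i) (E j) 1) ∧
      Module.finrank k (Ext (E i) (E j) 1) = if j = i' then 1 else 0 := by
  obtain ⟨α, hα, H⟩ := h.exists_ext
  split_ifs with hj
  · subst hj
    -- For `ξ ≠ 0` the map taking `ξ` to `α` is an endomorphism of a brick, hence a scalar, and the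
    -- scalar is nonzero because `α` is.
    have hspan : ∀ ξ : Ext (E i) (E j) 1, ∃ c : k, c • α = ξ := by
      intro ξ
      by_cases hξ : ξ = 0
      · exact ⟨0, by rw [zero_smul, hξ]⟩
      obtain ⟨f, hf⟩ := H _ hfd ξ hξ
      obtain ⟨c, rfl⟩ := (hE.isBrick j).2 f
      have hc : c • ξ = α := by rw [Ext.smul_eq_comp_mk₀]; exact hf
      have hc0 : c ≠ 0 := by rintro rfl; exact hα (by rw [← hc, zero_smul])
      exact ⟨c⁻¹, by rw [← hc, smul_smul, inv_mul_cancel₀ hc0, one_smul]⟩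
    have h1 := finrank_eq_one α hα hspan
    exact ⟨Module.finite_of_finrank_eq_succ h1, h1⟩
  · have h0 := rank_zero_iff.1 (hE.rank_of_ne j i' hj)
    have : Subsingleton (Ext (E i) (E j) 1) := by
      refine subsingleton_of_forall_eq 0 fun ξ => ?_
      by_contra hξ
      obtain ⟨f, hf⟩ := H _ hfd ξ hξ
      -- The map taking `ξ` to `α` runs between distinct bricks, so it is zero, contradicting `α ≠
      -- 0`.
      rw [h0.elim f 0, Ext.mk₀_zero, Ext.comp_zero] at hf
      exact hα hf.symm
    exact ⟨inferInstance, Module.finrank_zero_of_subsingleton⟩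

end AlmostSplit

/-! ### Hom spaces of brick sets and passage to full subcategories -/

section BrickSet

variable {k : Type u} [Field k] {C : Type*} [Category* C] [Preadditive C] [Linear k C]

lemma IsBrickSet.finrank_hom {ι : Type*} [DecidableEq ι] {X : ι → C} (h : IsBrickSet k X)
    (i j : ι) : Module.Finite k (X i ⟶ X j) ∧
      Module.finrank k (X i ⟶ X j) = if i = j then 1 else 0 := by
  split_ifs with hij
  · subst hij
    have h1 := Module.rank_eq_one_iff_finrank_eq_one.1 (h.rank_self i)
    exact ⟨Module.finite_of_finrank_eq_succ h1, h1⟩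
  · have h0 := rank_zero_iff.1 (h.rank_of_ne i j hij)
    exact ⟨inferInstance, Module.finrank_zero_of_subsingleton⟩

/-- Morphisms in a full subcategory, as a linear equivalence. -/
def fullSubcategoryHomEquiv (k : Type u) [Field k] [Linear k C] {P : ObjectProperty C}
    (X Y : P.FullSubcategory) :
    (X ⟶ Y) ≃ₗ[k] (X.obj ⟶ Y.obj) where
  toFun f := f.hom
  invFun f := P.homMk f
  map_add' _ _ := rfl
  map_smul' _ _ := rfl
  left_inv _ := rfl
  right_inv _ := rfl

lemma isBrickSet_fullSubcategory_iff {P : ObjectProperty C} {ι : Type*}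
    {X : ι → P.FullSubcategory} :
    IsBrickSet k X ↔ IsBrickSet k fun i => (X i).obj := by
  have hb : ∀ i, IsBrick k (X i) ↔ IsBrick k (X i).obj := fun i =>
    (Function.Bijective.of_comp_iff' (fullSubcategoryHomEquiv k (X i) (X i)).bijective
      (fun c : k => c • 𝟙 (X i))).symm
  have hr : ∀ i j, Module.rank k (X i ⟶ X j) = Module.rank k ((X i).obj ⟶ (X j).obj) :=
    fun i j => (fullSubcategoryHomEquiv k (X i) (X j)).rank_eq
  constructor
  · exact fun h => ⟨fun i => (hb i).1 (h.1 i), fun i => (hr i i).symm.trans (h.2 i),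
      fun i j hij => (hr i j).symm.trans (h.3 i j hij)⟩
  · exact fun h => ⟨fun i => (hb i).2 (h.1 i), fun i => (hr i i).trans (h.2 i),
      fun i j hij => (hr i j).trans (h.3 i j hij)⟩

end BrickSet

/-! ### Extensions in the extension category -/

section ExtensionCategory

variable {k : Type u} [Field k] {A : Type v} [Ring A] [Algebra k A] {ι : Type w}
  {E : ι → ModuleCat.{v} A}

lemma IsBrickSet.extensionCategory_self (h : IsBrickSet k E) (j : ι) :
    extensionCategory E (E j) := by
  have := h.nontrivial
  refine ⟨0 + 1, HasFiltration.succ (j := j) LinearMap.id Function.surjective_id ?_⟩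
  rw [hasFiltration_zero_iff, LinearMap.ker_id]
  infer_instance

/-- This closure property makes the comparison of `Ext¹` with that of modules surjective. -/
lemma IsBrickSet.extensionCategory_of_shortExact (h : IsBrickSet k E)
    {S : ShortComplex (ModuleCat.{v} A)} (hS : S.ShortExact)
    (h₁ : extensionCategory E S.X₁) (h₃ : extensionCategory E S.X₃) :
    extensionCategory E S.X₂ := by
  have := h.nontrivial
  obtain ⟨a, ha⟩ := h₁
  obtain ⟨b, hb⟩ := h₃
  have hex := (ShortComplex.ShortExact.moduleCat_exact_iff_function_exact S).1 hS.exact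
  refine ⟨a + b, HasFiltration.extension S.g.hom ((ModuleCat.epi_iff_surjective _).1 hS.epi_g)
    (ha.congr ?_) hb⟩
  exact (LinearEquiv.ofInjective S.f.hom ((ModuleCat.mono_iff_injective _).1 hS.mono_f)) ≪≫ₗ
    LinearEquiv.ofEq _ _ (LinearMap.exact_iff.1 hex).symm

/-- The extension groups of degree one of the extension category agree with those of modules. -/
lemma IsBrickSet.toENat_rank_ext_one (h : IsBrickSet k E)
    (X Y : (extensionCategory E).FullSubcategory) [Module.Finite k (Ext X.obj Y.obj 1)] :
    letI := h.abelian
    letI : HasExt.{v + 1} (extensionCategory E).FullSubcategory := HasExt.standard _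
    Cardinal.toENat (Module.rank k (Ext X Y 1)) = Module.finrank k (Ext X.obj Y.obj 1) := by
  let := h.abelian
  let : HasExt.{v + 1} (extensionCategory E).FullSubcategory := HasExt.standard _
  have := h.isClosedUnderKernels
  have := h.isClosedUnderCokernels
  have := h.isClosedUnderFiniteProducts
  let F : (extensionCategory E).FullSubcategory ⥤ ModuleCat.{v} A := (extensionCategory E).ι
  have hk : ∀ {X Y : (extensionCategory E).FullSubcategory} (f : X ⟶ Y),
      PreservesLimit (parallelPair f 0) F := fun f => (extensionCategory E).preservesKernels_ι f
  have hc : ∀ {X Y : (extensionCategory E).FullSubcategory} (f : X ⟶ Y),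
      PreservesColimit (parallelPair f 0) F := fun f => (extensionCategory E).preservesCokernels_ι f
  have : F.Additive := { map_add := rfl }
  have : F.Linear k := { map_smul := fun _ _ => rfl }
  -- Kernels and cokernels in the subcategory are computed in modules, so the inclusion is exact.
  have : PreservesFiniteLimits F := F.preservesFiniteLimits_of_preservesKernels
  have : PreservesFiniteColimits F := F.preservesFiniteColimits_of_preservesCokernels
  let e : Ext X Y 1 ≃ₗ[k] Ext X.obj Y.obj 1 := LinearEquiv.ofBijective (F.mapExtLinearMap k X Y 1)
    ⟨Ext.mapExactFunctor_one_injective F X Y, Ext.mapExactFunctor_one_surjective F X Y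
      fun S hS h₁ h₃ => ⟨⟨S.X₂, h.extensionCategory_of_shortExact hS
        (h₁ ▸ Y.property) (h₃ ▸ X.property)⟩, rfl⟩⟩
  have : Module.Finite k (Ext X Y 1) := Module.Finite.equiv e.symm
  rw [← e.finrank_eq, ← Module.finrank_eq_rank, map_natCast]

end ExtensionCategory

end FP

/-! ### The Frobenius-Perron dimension of a cycle of bricks -/

namespace FP

section Cycle

variable {k : Type u} [Field k] {A : Type v} [Ring A] [Algebra k A] {r : ℕ}
  {E : ZMod r → ModuleCat.{v} A}

lemma IsBrickSet.finrank_ext_zero {ι : Type*} [DecidableEq ι] {X : ι → ModuleCat.{v} A}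
    (h : IsBrickSet k X) (i j : ι) :
    Module.Finite k (Ext (X i) (X j) 0) ∧
      Module.finrank k (Ext (X i) (X j) 0) = if i = j then 1 else 0 := by
  obtain ⟨h₁, h₂⟩ := h.finrank_hom i j
  exact ⟨Module.Finite.equiv Ext.linearEquiv₀.symm,
    (Ext.linearEquiv₀ (R := k)).finrank_eq.trans h₂⟩

/-- `Hom` contributes the vertices of the cyclic quiver and `Ext¹` its arrows `i → i - 1`. For `r =
1` both conditions hold and the value is `0`, as for a loop. -/
lemma IsBrickSet.eulerForm_eq (hfd : ∀ i, finDimModules k (E i))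
    (hbrick : IsBrickSet k E) (hτ : ∀ i, IsARTranslate k (E (i - 1)) (E i))
    (hsh : ∀ i j, Subsingleton (Ext (E i) (E j) 2)) (i j : ZMod r) :
    IsEulerPair k (E i) (E j) ∧
      eulerForm k (E i) (E j) = (if i = j then 1 else 0) - if j = i - 1 then 1 else 0 := by
  obtain ⟨h₁, h₂⟩ := hbrick.finrank_ext_zero i j
  obtain ⟨h₃, h₄⟩ := hbrick.finrank_ext_one (hfd j) (hτ i)
  refine ⟨⟨h₁, h₃, hsh i j⟩, ?_⟩
  simp [eulerForm, h₂, h₄]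

/-- On the extension category of a cycle of bricks, the Euler form is that of a cyclic quiver. -/
lemma IsBrickSet.exists_multiplicity [NeZero r] (hfd : ∀ i, finDimModules k (E i))
    (hbrick : IsBrickSet k E) (hτ : ∀ i, IsARTranslate k (E (i - 1)) (E i))
    (hsh : ∀ i j, Subsingleton (Ext (E i) (E j) 2)) {ι : Type*} (X : ι → ModuleCat.{v} A)
    (hX : ∀ s, extensionCategory E (X s)) :
    ∃ x : ι → ZMod r → ℕ, ∀ s t, IsEulerPair k (X s) (X t) ∧
      eulerForm k (X s) (X t) = ∑ i, ((x s i : ℤ) * x t i - x s i * x t (i - 1)) := by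
  have hE := hbrick.eulerForm_eq hfd hτ hsh
  have hM : ∀ s, ∃ x : ZMod r → ℕ, _ := fun s =>
    (hX s).choose_spec.exists_multiplicity (k := k)
  choose x hx₁ hx₂ using hM
  refine ⟨x, fun s t => ?_⟩
  -- The second argument is expanded first. This also supplies the Euler pairs `(E i, X t)` needed
  -- to expand the first one.
  have ht : ∀ i, IsEulerPair k (E i) (X t) ∧
      eulerForm k (E i) (X t) = (x t i : ℤ) - x t (i - 1) := by
    intro i
    obtain ⟨h, he⟩ := hx₂ t (E i) fun j => (hE i j).1
    refine ⟨h, he.trans ?_⟩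
    simp [(hE _ _).2, mul_sub, Finset.sum_sub_distrib]
  obtain ⟨h, he⟩ := hx₁ s (X t) fun j => (ht j).1
  refine ⟨h, he.trans (Finset.sum_congr rfl fun i _ => ?_)⟩
  rw [(ht i).2, mul_sub]

/-- The spectral radius of the adjacency matrix of a brick set in the extension category. -/
lemma IsBrickSet.matrixSpectralRadius_extAdjacencyMatrix (hbrick : IsBrickSet k E) {n : ℕ}
    (X : Fin n → (extensionCategory E).FullSubcategory)
    (hX : ∀ s t, Module.Finite k (Ext (X s).obj (X t).obj 1)) :
    letI := hbrick.abelian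
    matrixSpectralRadius (extAdjacencyMatrix k X) =
      spectralRadius ℂ ((Matrix.of fun s t =>
        Module.finrank k (Ext (X s).obj (X t).obj 1)).map ((↑) : ℕ → ℂ)) := by
  rw [← matrixSpectralRadius_natCast]
  congr 1
  ext s t : 2
  exact hbrick.toENat_rank_ext_one (X s) (X t)

end Cycle

end FP

theorem theorem2p11 {k : Type u} [Field k] [IsAlgClosed k] {A : Type v} [Ring A] [Algebra k A]
    {r : ℕ} [NeZero r] (E : ZMod r → ModuleCat.{v} A)
    (hfd : ∀ i, FP.finDimModules k (E i))
    (hbrick : FP.IsBrickSet k E)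
    (hτ : ∀ i, FP.IsARTranslate k (E (i - 1)) (E i))
    (hsh : ∀ i j, Subsingleton (Ext (E i) (E j) 2)) :
    letI : Abelian (FP.extensionCategory E).FullSubcategory := hbrick.abelian
    FP.fpdim k (FP.extensionCategory E).FullSubcategory = 1 := by
  let : Abelian (FP.extensionCategory E).FullSubcategory := hbrick.abelian
  apply le_antisymm
  · refine iSup₂_le fun n _ => iSup₂_le fun X hX => ?_
    have hX' := FP.isBrickSet_fullSubcategory_iff.1 hX
    obtain ⟨x, hx⟩ := hbrick.exists_multiplicity hfd hτ hsh (fun s => (X s).obj)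
      fun s => (X s).property
    refine (hbrick.matrixSpectralRadius_extAdjacencyMatrix X
      fun s t => (hx s t).1.finite_one).trans_le ?_
    -- The arrows of the quiver give the permutation `i ↦ i - 1`. The identity matrix in the Gram
    -- condition is the matrix of `dim Hom` of the brick set `X`.
    refine FP.spectralRadius_le_one_of_gram (Equiv.subRight (1 : ZMod r)) _ x fun s t => ?_
    have h := (hx s t).2
    rw [FP.eulerForm, (hX'.finrank_ext_zero s t).2] at h
    simp only [Equiv.subRight_apply, ← h, Matrix.of_apply]
    push_cast
    ring
  -- The lower bound comes from the cycle itself. Brick sets are indexed by `Fin n`, so the `E i`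
  -- are listed in an arbitrary order.
  · let e : Fin r ≃ ZMod r := Fintype.equivOfCardEq (by simp)
    let X : Fin r → (FP.extensionCategory E).FullSubcategory := fun s =>
      ⟨E (e s), hbrick.extensionCategory_self (e s)⟩
    have hX : FP.IsBrickSet k X := FP.isBrickSet_fullSubcategory_iff.2
      ⟨fun s => hbrick.1 (e s), fun s => hbrick.2 (e s),
        fun s t hst => hbrick.3 _ _ (e.injective.ne hst)⟩
    have hext := fun s t : Fin r => hbrick.finrank_ext_one (hfd (e t)) (hτ (e s))
    refine le_trans ?_ (le_iSup₂_of_le (f := fun n _ => FP.fpdimN k _ n) r NeZero.one_le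
      (le_iSup₂_of_le X hX le_rfl))
    refine le_trans ?_ (hbrick.matrixSpectralRadius_extAdjacencyMatrix X
      fun s t => (hext s t).1).ge
    refine FP.one_le_spectralRadius_of_row_sum _ fun s => ?_
    -- Row `s` has its only nonzero entry in the column listing the translate of `E (e s)`.
    have hrow : ∀ t, Matrix.of (fun s t => Module.finrank k (Ext (X s).obj (X t).obj 1)) s t =
        if t = e.symm (e s - 1) then 1 else 0 := by
      intro t
      refine (hext s t).2.trans ?_
      simp only [Equiv.eq_symm_apply]
    simp [hrow]
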